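/- Fix a first-order language $L$ with at least one constant; all terms, atoms, programs, queries and ground instances are over $L$. A (general) program is a finite set of clauses $H\leftarrow L_1,\dots,L_m$ ($m\ge 0$) with $H$ an atom and each $L_j$ a literal; a query is a finite, possibly empty, sequence of literals. A relation is defined in a program if it occurs in the head of one of its clauses; an atom is defined in a program if its relation is. Programs $R_1,\dots,R_n$ form a hierarchy $R_n\sqsupset\cdots\sqsupset R_1$ if for each $i$ no relation defined in $R_{i+1}$ occurs in $R_1\cup\dots\cup R_i$. LDNF-resolution is SLDNF-resolution that always selects the leftmost literal: if it is an atom, the query is resolved with variants, standardized apart, of clauses of $P$ via most general unifiers; if it is a ground negative literal $\neg A$, a subsidiary LDNF-tree for $A$ is built, $\neg A$ is deleted if that tree is finitely failed, and the query fails if that tree contains a successful branch; if it is a non-ground negative literal, the derivation ends (it flounders). A derivation also counts as infinite if the construction of a subsidiary tree diverges. $\mathit{Call}_P(Q)$ is the set of first literals of the non-empty queries that occur in the LDNF-tree of $P\cup\{Q\}$ (including $Q$ itself) or in its subsidiary LDNF-trees, at any depth of nesting. For a program $P$, let $\mathit{Neg}_P$ be the set of relations occurring in a negative literal of a clause of $P$,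 $\mathit{Neg}^*_P$ the set of relations on which those in $\mathit{Neg}_P$ depend (where dependence is the reflexive-transitive closure of "occurs in the body of a clause with head relation"), and $P^-$ the set of clauses of $P$ defining a relation of $\mathit{Neg}^*_P$. A (not necessarily Herbrand) model $M$ of $P$ is complete if its restriction to the relations of $\mathit{Neg}^*_P$ is a model of Clark's completion of $P^-$ (the completed definitions of all relations of $\mathit{Neg}^*_P$, those without clauses being empty, and the free equality axioms for $L$); if $P$ contains no negative literal, every model of $P$ is complete. A level mapping assigns a natural number $|A|$ to each ground atom $A$, and $|\neg A|=|A|$. A program $R$ is acceptable with respect to $|\cdot|$ and $M$ if for every ground instance $A\leftarrow \mathbf A,B,\mathbf B$ of a clause of $R$ (with $B$ a literal and $\mathbf A,\mathbf B$ sequences of literals), $M\models\mathbf A$ implies $|A|>|B|$. An atom is bounded with respect to $|\cdot|$ if the set of levels of its ground instances is finite. **Theorem.** Let $P=R_1\cup\dots\cup R_n$, where $R_n\sqsupset\cdots\sqsupset R_1$ is a hierarchy of programs, let $|\cdot|_1,\dots,|\cdot|_n$ be level mappings for $R_1,\dots,R_n$ respectively, and let $M$ be a complete model of $P$. Suppose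 that $R_i$ is acceptable with respect to $|\cdot|_i$ and $M$ for every $i\in\{1,\dots,n\}$. Let $Q$ be a query that is strongly bounded with respect to $P$ and $|\cdot|_1,\dots,|\cdot|_n$, that is, for every atom $A\in\mathit{Call}_P(Q)$ and every $i$, if $A$ is defined in $R_i$ then $A$ is bounded with respect to $|\cdot|_i$. Then all LDNF-derivations of $P\cup\{Q\}$ are finite. -/

import Mathlib

universe u v w

namespace LogicProg

open FirstOrder.Language (Term)

/-! ### Syntax

A single first-order language `L` is fixed, in which all programs and queries are written; the
variables are the natural numbers. An atom over the empty set of variables is a ground atom. -/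

/-- Relation symbols, together with their arities. -/
abbrev Rel (L : FirstOrder.Language.{u, v}) : Type v := Σ k, L.Relations k

/-- Atoms `r(t₁,…,t_k)` with variables in `α`. -/
structure Atom (L : FirstOrder.Language.{u, v}) (α : Type) where
  arity : ℕ
  sym : L.Relations arity
  args : Fin arity → L.Term α

/-- Literals: atoms and negated atoms. -/
inductive Literal (L : FirstOrder.Language.{u, v}) (α : Type)
  | pos (A : Atom L α) : Literal L α
  | neg (A : Atom L α) : Literal L α

/-- General queries: possibly empty finite sequences of literals. -/
abbrev Query (L : FirstOrder.Language.{u, v}) := List (Literal L ℕ)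

/-- General clauses `H ← L₁,…,Lₙ`. -/
structure Clause (L : FirstOrder.Language.{u, v}) where
  head : Atom L ℕ
  body : Query L

/-- Sets of general clauses. (That a program is finite is a separate hypothesis.) -/
abbrev Program (L : FirstOrder.Language.{u, v}) := Set (Clause L)

variable {L : FirstOrder.Language.{u, v}} {α β : Type}

/-- Ground atoms of the language. -/
abbrev GroundAtom (L : FirstOrder.Language.{u, v}) := Atom L Empty

def Atom.rel (A : Atom L α) : Rel L := ⟨A.arity, A.sym⟩

def Atom.subst (A : Atom L α) (σ : α → L.Term β) : Atom L β :=
  ⟨A.arity, A.sym, fun i => (A.args i).subst σ⟩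

/-- The variables occurring in an atom. -/
def Atom.vars (A : Atom L ℕ) : Set ℕ := {x | ∃ i, x ∈ (A.args i).varFinset}

def Atom.IsGround (A : Atom L ℕ) : Prop := A.vars = ∅

/-- The atom underlying a literal. -/
def Literal.atom : Literal L α → Atom L α
  | .pos A => A
  | .neg A => A

/-- The relation symbol of a literal. -/
def Literal.rel (l : Literal L α) : Rel L := l.atom.rel

def Literal.subst : Literal L α → (α → L.Term β) → Literal L β
  | .pos A, σ => .pos (A.subst σ)
  | .neg A, σ => .neg (A.subst σ)

def Query.subst (Q : Query L) (σ : ℕ → L.Term ℕ) : Query L := Q.map fun l => l.subst σ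

def Query.vars (Q : Query L) : Set ℕ := {x | ∃ l ∈ Q, x ∈ l.atom.vars}

def Clause.vars (c : Clause L) : Set ℕ := c.head.vars ∪ Query.vars c.body

/-- The variant of a clause obtained by renaming its variables by the permutation `ρ`. -/
def Clause.rename (c : Clause L) (ρ : Equiv.Perm ℕ) : Clause L :=
  ⟨c.head.subst fun x => Term.var (ρ x),
    Query.subst c.body fun x => Term.var (ρ x)⟩

/-- `p` is defined in `P`: it occurs in the head of a clause of `P`. -/
def DefinedIn (P : Program L) (p : Rel L) : Prop := ∃ c ∈ P, c.head.rel = p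

/-- `p` occurs in `P`, in a head or in a body. -/
def OccursIn (P : Program L) (p : Rel L) : Prop :=
  ∃ c ∈ P, c.head.rel = p ∨ ∃ l ∈ c.body, l.rel = p

/-- `P ⊐ R`: no relation defined in `P` occurs in `R`. -/
def Extends (P R : Program L) : Prop := ∀ p, DefinedIn P p → ¬ OccursIn R p

/-- `R_n ⊐ ⋯ ⊐ R_1` is a hierarchy: each module extends the union of the preceding ones. -/
def IsHierarchy {n : ℕ} (R : Fin n → Program L) : Prop :=
  ∀ i, Extends (R i) (⋃ j : {j : Fin n // j < i}, R j)

/-! ### LDNF-resolution -/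

/-- `σ` is a most general unifier of the atoms `A` and `B`. -/
def IsMGU (σ : ℕ → L.Term ℕ) (A B : Atom L ℕ) : Prop :=
  A.subst σ = B.subst σ ∧
    ∀ τ : ℕ → L.Term ℕ, A.subst τ = B.subst τ →
      ∃ δ : ℕ → L.Term ℕ, ∀ x, τ x = (σ x).subst δ

/-- `Resolvent P Q Q'`: the first literal of `Q` is positive and `Q'` is a resolvent of `Q` with
respect to that literal and a variant, standardized apart from `Q`, of a clause of `P`. -/
inductive Resolvent (P : Program L) : Query L → Query L → Prop
  | mk (A : Atom L ℕ) (Q : Query L) (c : Clause L) (hc : c ∈ P) (ρ : Equiv.Perm ℕ)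
      (σ : ℕ → L.Term ℕ)
      (apart : Disjoint (c.rename ρ).vars (Query.vars (Literal.pos A :: Q)))
      (mgu : IsMGU σ A (c.rename ρ).head) :
      Resolvent P (Literal.pos A :: Q) (Query.subst ((c.rename ρ).body ++ Q) σ)

inductive Outcome
  | success
  | failure

/-- `HasOutcome P .success Q`: the LDNF-tree of `P ∪ {Q}` is successful, that is, has a branch
ending in the empty query. `HasOutcome P .failure Q`: it is finitely failed, that is, it is finite
and all its branches end in failure. A ground `¬A` in first position is deleted if the subsidiary
tree of `A` is finitely failed, and the query fails if the subsidiary tree is successful. A query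
whose first literal is negative and not ground (floundering) has neither outcome. -/
inductive HasOutcome (P : Program L) : Outcome → Query L → Prop
  | success_nil : HasOutcome P .success []
  | success_pos (A : Atom L ℕ) (Q Q' : Query L) (hr : Resolvent P (Literal.pos A :: Q) Q')
      (h : HasOutcome P .success Q') : HasOutcome P .success (Literal.pos A :: Q)
  | success_neg (A : Atom L ℕ) (Q : Query L) (hA : A.IsGround)
      (hfail : HasOutcome P .failure [Literal.pos A])
      (h : HasOutcome P .success Q) : HasOutcome P .success (Literal.neg A :: Q)
  | failure_pos (A : Atom L ℕ) (Q : Query L)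
      (h : ∀ Q', Resolvent P (Literal.pos A :: Q) Q' → HasOutcome P .failure Q') :
      HasOutcome P .failure (Literal.pos A :: Q)
  | failure_neg (A : Atom L ℕ) (Q : Query L) (hA : A.IsGround)
      (hsucc : HasOutcome P .success [Literal.pos A]) :
      HasOutcome P .failure (Literal.neg A :: Q)
  | failure_neg_next (A : Atom L ℕ) (Q : Query L) (hA : A.IsGround)
      (hfail : HasOutcome P .failure [Literal.pos A])
      (h : HasOutcome P .failure Q) : HasOutcome P .failure (Literal.neg A :: Q)

/-- One move of the interpreter: to a direct descendant in the same LDNF-tree (`resolve`, `delete`),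
or to the root of the subsidiary LDNF-tree called by a ground negative first literal (`call`). -/
inductive Next (P : Program L) : Query L → Query L → Prop
  | resolve (Q Q' : Query L) (h : Resolvent P Q Q') : Next P Q Q'
  | delete (A : Atom L ℕ) (Q : Query L) (hA : A.IsGround)
      (hfail : HasOutcome P .failure [Literal.pos A]) : Next P (Literal.neg A :: Q) Q
  | call (A : Atom L ℕ) (Q : Query L) (hA : A.IsGround) :
      Next P (Literal.neg A :: Q) [Literal.pos A]

/-- `Q'` is an LDNF-descendant of `P ∪ {Q}`: it is `Q` itself or occurs in the LDNF-tree of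
`P ∪ {Q}` or in one of the subsidiary LDNF-trees. -/
def IsDescendant (P : Program L) (Q Q' : Query L) : Prop := Relation.ReflTransGen (Next P) Q Q'

/-- `Call_P(Q)`: the first literals of the non-empty LDNF-descendants of `P ∪ {Q}`. -/
def Call (P : Program L) (Q : Query L) : Set (Literal L ℕ) :=
  {l | ∃ Q', IsDescendant P Q (l :: Q')}

/-- All LDNF-derivations of `P ∪ {Q}` are finite. A derivation also counts as infinite if the
interpreter diverges in the construction of a subsidiary tree (by an infinite branch there, by
divergence in a further subsidiary tree, or by infinitely nested subsidiary trees); so what is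
excluded is an infinite sequence of moves within trees and into subsidiary trees. -/
def AllDerivationsFinite (P : Program L) (Q : Query L) : Prop :=
  ¬ ∃ s : ℕ → Query L, s 0 = Q ∧ ∀ k, Next P (s k) (s (k + 1))

/-! ### Models and completion -/

section Semantics

variable (M : Type w) [L.Structure M]

def Atom.Realize (A : Atom L α) (e : α → M) : Prop :=
  FirstOrder.Language.Structure.RelMap A.sym fun i => (A.args i).realize e

def Literal.Realize : Literal L α → (α → M) → Prop
  | .pos A, e => A.Realize M e
  | .neg A, e => ¬ A.Realize M e

/-- Truth of a ground literal in `M`. -/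
def Literal.Holds (l : Literal L Empty) : Prop := l.Realize M Empty.elim

/-- `M` is a model of `P`. -/
def IsModel (P : Program L) : Prop :=
  ∀ c ∈ P, ∀ e : ℕ → M, (∀ l ∈ c.body, l.Realize M e) → c.head.Realize M e

/-- Clark's free equality axioms, with equality interpreted as identity. -/
structure FreeEquality (L : FirstOrder.Language.{u, v}) (M : Type w) [L.Structure M] : Prop where
  injective : ∀ {k : ℕ} (f : L.Functions k) (x y : Fin k → M),
    FirstOrder.Language.Structure.funMap f x = FirstOrder.Language.Structure.funMap f y → x = y
  disjoint : ∀ {k m : ℕ} (f : L.Functions k) (g : L.Functions m) (x : Fin k → M) (y : Fin m → M),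
    (⟨k, f⟩ : Σ k, L.Functions k) ≠ ⟨m, g⟩ →
      FirstOrder.Language.Structure.funMap f x ≠ FirstOrder.Language.Structure.funMap g y
  acyclic : ∀ (x : ℕ) (t : L.Term ℕ), x ∈ t.varFinset → t ≠ Term.var x →
    ∀ e : ℕ → M, e x ≠ t.realize e

/-- The restriction of `M` to the relations in `S` is a model of Clark's completion of `P`, in the
language with relation symbols `S`: the free equality axioms and the completed definition of every
relation in `S` hold. (The completed definition of a relation that heads no clause of `P` says
that it is empty.) -/
structure IsCompletionModel (S : Set (Rel L)) (P : Program L) : Prop where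
  freeEquality : FreeEquality L M
  completedDef : ∀ {k : ℕ} (r : L.Relations k), (⟨k, r⟩ : Rel L) ∈ S → ∀ x : Fin k → M,
    FirstOrder.Language.Structure.RelMap r x ↔
      ∃ c ∈ P, ∃ args : Fin k → L.Term ℕ, c.head = ⟨k, r, args⟩ ∧
        ∃ e : ℕ → M, (∀ i, x i = (args i).realize e) ∧ ∀ l ∈ c.body, l.Realize M e

end Semantics

/-- `p` refers to `q` in `P`. -/
def RefersTo (P : Program L) (p q : Rel L) : Prop :=
  ∃ c ∈ P, c.head.rel = p ∧ ∃ l ∈ c.body, l.rel = q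

/-- `p` depends on `q` in `P`. -/
def DependsOn (P : Program L) : Rel L → Rel L → Prop := Relation.ReflTransGen (RefersTo P)

/-- `Neg_P`: the relations occurring in a negative literal of a clause of `P`. -/
def NegRel (P : Program L) : Set (Rel L) :=
  {p | ∃ c ∈ P, ∃ A : Atom L ℕ, Literal.neg A ∈ c.body ∧ A.rel = p}

/-- `Neg*_P`: the relations on which the relations in `Neg_P` depend. -/
def NegStar (P : Program L) : Set (Rel L) := {q | ∃ p ∈ NegRel P, DependsOn P p q}

/-- `P⁻`: the clauses of `P` that define a relation of `Neg*_P`. -/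
def NegPart (P : Program L) : Program L := {c ∈ P | c.head.rel ∈ NegStar P}

/-- `M` is a complete model of `P`: a model of `P` whose restriction to the relations of `Neg*_P` is
a model of the completion of `P⁻`. If `P` is definite then `Neg*_P` and `P⁻` are empty and there is
no second condition (not even the equality axioms): every model is complete. -/
def IsCompleteModel (M : Type w) [L.Structure M] (P : Program L) : Prop :=
  IsModel M P ∧ ((NegStar P).Nonempty → IsCompletionModel M (NegStar P) (NegPart P))

/-! ### Acceptability and boundedness -/

/-- Level mappings. -/
abbrev LevelMapping (L : FirstOrder.Language.{u, v}) := GroundAtom L → ℕ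

/-- The decrease condition of acceptability with respect to `lev` and `M`: for all ground instances
`A ← 𝐀, B, 𝐁` of clauses of `P`, if `M ⊨ 𝐀` then `lev A > lev B`, where `lev (¬B) = lev B`. -/
def IsAcceptable (P : Program L) (lev : LevelMapping L) (M : Type w) [L.Structure M] : Prop :=
  ∀ c ∈ P, ∀ γ : ℕ → L.Term Empty, ∀ (pre post : Query L) (l : Literal L ℕ),
    c.body = pre ++ l :: post → (∀ l' ∈ pre, (l'.subst γ).Holds M) →
      lev (l.subst γ).atom < lev (c.head.subst γ)

/-- `A` is bounded: the levels of its ground instances form a finite set. -/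
def IsBounded (lev : LevelMapping L) (A : Atom L ℕ) : Prop :=
  (Set.range fun γ : ℕ → L.Term Empty => lev (A.subst γ)).Finite

/-- `Q` is strongly bounded with respect to `R_1 ∪ ⋯ ∪ R_n` and the level mappings `lev i`. -/
def IsStronglyBounded {n : ℕ} (R : Fin n → Program L) (lev : Fin n → LevelMapping L)
    (Q : Query L) : Prop :=
  ∀ A : Atom L ℕ, Literal.pos A ∈ Call (⋃ i, R i) Q →
    ∀ i, DefinedIn (R i) A.rel → IsBounded (lev i) A

end LogicProg

namespace LogicProg

open FirstOrder.Language (Term)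

variable {L : FirstOrder.Language.{u, v}} {α β γ : Type}

/-! ### Substitutions -/

/-! The induction is lexicographic, on the module defining the selected atom and then on a bound for
its levels. A call is treated together with the query behind it: `ContinuationsTerminate` assumes
that what remains once the first literal is removed terminates, but only under answers that make
this literal true in `M`. `terminates_pos_cons` consumes a clause body from left to right under this
hypothesis. When a body literal is selected, its predecessors are true in `M`, so acceptability
lowers the level within a module. If the literal is defined in a lower module, strong boundedness
supplies a fresh bound. Level mappings of different modules are thus never compared.

The truth of the predecessors has two sources. A resolved atom is true because its whole body is and
`M` is a model. A deleted `¬A` from a body is true because `A` finitely failed and its relation lies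
in `Neg*`: by `HasOutcome.sound`, `A` is then false in `M`. Soundness of failure uses the only-if
half of the completion: a true instance of a query lifts to a true instance of some resolvent. As
`M` need not be Herbrand, this lifting needs `exists_isUnifierFor`: equations solved in `M` have a
most general unifier through which that solution factors. -/

theorem Term.subst_subst (t : L.Term α) (σ : α → L.Term β) (τ : β → L.Term γ) :
    (t.subst σ).subst τ = t.subst fun x => (σ x).subst τ := by
  induction t with
  | var => rfl
  | func _ _ ih => simp [Term.subst, ih]

theorem Term.subst_var (t : L.Term α) : t.subst Term.var = t := by
  induction t with
  | var => rfl
  | func _ _ ih => simp [Term.subst, ih]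

theorem Term.subst_congr {t : L.Term ℕ} {σ τ : ℕ → L.Term β}
    (h : ∀ x ∈ t.varFinset, σ x = τ x) : t.subst σ = t.subst τ := by
  induction t with
  | var x => exact h x (by simp)
  | func f ts ih =>
    simp only [Term.subst, Term.func.injEq, heq_eq_eq, true_and]
    funext i
    exact ih i fun x hx => h x (by simpa using ⟨i, hx⟩)

theorem Term.realize_congr {M : Type w} [L.Structure M] {t : L.Term ℕ} {e e' : ℕ → M}
    (h : ∀ x ∈ t.varFinset, e x = e' x) : t.realize e = t.realize e' := by
  induction t with
  | var x => exact h x (by simp)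
  | func f ts ih =>
    simp only [Term.realize]
    congr 1
    funext i
    exact ih i fun x hx => h x (by simpa using ⟨i, hx⟩)

theorem Term.mem_varFinset_subst {t : L.Term ℕ} {σ : ℕ → L.Term ℕ} {y : ℕ} :
    y ∈ (t.subst σ).varFinset ↔ ∃ x ∈ t.varFinset, y ∈ (σ x).varFinset := by
  induction t with
  | var x => simp [Term.subst]
  | func f ts ih =>
    simp only [Term.subst, Term.varFinset, Finset.mem_biUnion, Finset.mem_univ, true_and, ih]
    exact ⟨fun ⟨i, x, hx, hy⟩ => ⟨x, ⟨i, hx⟩, hy⟩, fun ⟨x, ⟨i, hx⟩, hy⟩ => ⟨i, x, hx, hy⟩⟩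

theorem Atom.subst_subst (A : Atom L α) (σ : α → L.Term β) (τ : β → L.Term γ) :
    (A.subst σ).subst τ = A.subst fun x => (σ x).subst τ := by
  simp [Atom.subst, Term.subst_subst]

theorem Atom.subst_var (A : Atom L α) : A.subst Term.var = A := by
  simp [Atom.subst, Term.subst_var]

theorem Atom.subst_of_isGround {A : Atom L ℕ} (hA : A.IsGround) (σ : ℕ → L.Term ℕ) :
    A.subst σ = A := by
  conv_rhs => rw [← A.subst_var]
  simp only [Atom.subst, Atom.mk.injEq, heq_eq_eq, true_and]
  funext i
  refine Term.subst_congr fun x hx => ?_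
  have : x ∈ A.vars := ⟨i, hx⟩
  simp [show A.vars = ∅ from hA] at this

@[simp]
theorem Atom.rel_subst (A : Atom L α) (σ : α → L.Term β) : (A.subst σ).rel = A.rel := rfl

@[simp]
theorem Literal.atom_subst (l : Literal L α) (σ : α → L.Term β) :
    (l.subst σ).atom = l.atom.subst σ := by
  cases l <;> rfl

@[simp]
theorem Literal.rel_subst (l : Literal L α) (σ : α → L.Term β) : (l.subst σ).rel = l.rel := by
  simp [Literal.rel]

theorem Literal.subst_subst (l : Literal L α) (σ : α → L.Term β) (τ : β → L.Term γ) :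
    (l.subst σ).subst τ = l.subst fun x => (σ x).subst τ := by
  cases l <;> simp [Literal.subst, Atom.subst_subst]

theorem Literal.subst_var (l : Literal L α) : l.subst Term.var = l := by
  cases l <;> simp [Literal.subst, Atom.subst_var]

theorem Query.subst_subst (Q : Query L) (σ τ : ℕ → L.Term ℕ) :
    (Q.subst σ).subst τ = Q.subst fun x => (σ x).subst τ := by
  simp [Query.subst, Literal.subst_subst]

theorem Query.subst_var (Q : Query L) : Q.subst Term.var = Q := by
  simp [Query.subst, Literal.subst_var]

theorem Query.subst_append (Q Q' : Query L) (σ : ℕ → L.Term ℕ) :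
    Query.subst (Q ++ Q') σ = Q.subst σ ++ Q'.subst σ :=
  List.map_append

section Realize

variable {M : Type w} [L.Structure M]

theorem Atom.realize_subst (A : Atom L α) (σ : α → L.Term β) (e : β → M) :
    (A.subst σ).Realize M e ↔ A.Realize M fun x => (σ x).realize e := by
  simp [Atom.subst, Atom.Realize]

theorem Literal.realize_subst (l : Literal L α) (σ : α → L.Term β) (e : β → M) :
    (l.subst σ).Realize M e ↔ l.Realize M fun x => (σ x).realize e := by
  cases l <;> simp [Literal.subst, Literal.Realize, Atom.realize_subst]

theorem Atom.realize_congr {A : Atom L ℕ} {e e' : ℕ → M} (h : ∀ x ∈ A.vars, e x = e' x) :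
    A.Realize M e ↔ A.Realize M e' := by
  have : ∀ i, (A.args i).realize e = (A.args i).realize e' :=
    fun i => Term.realize_congr fun x hx => h x ⟨i, hx⟩
  simp [Atom.Realize, this]

theorem Literal.realize_congr {l : Literal L ℕ} {e e' : ℕ → M}
    (h : ∀ x ∈ l.atom.vars, e x = e' x) : l.Realize M e ↔ l.Realize M e' := by
  cases l with
  | pos A => exact Atom.realize_congr h
  | neg A => exact not_congr (Atom.realize_congr h)

end Realize

/-! ### Unification -/

/-- The number of symbols of a term. -/
def Term.size : L.Term α → ℕ
  | .var _ => 1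
  | .func _ ts => 1 + ∑ i, Term.size (ts i)

/-- `σ` solves the equations `E` and every solution `τ` of `E`, in the terms, as well as the
solution `e` in `M`, factors through `σ` by way of itself. -/
def IsUnifierFor {M : Type w} [L.Structure M] (E : List (L.Term ℕ × L.Term ℕ)) (e : ℕ → M)
    (σ : ℕ → L.Term ℕ) : Prop :=
  (∀ p ∈ E, p.1.subst σ = p.2.subst σ) ∧
    (∀ τ : ℕ → L.Term ℕ, (∀ p ∈ E, p.1.subst τ = p.2.subst τ) → ∀ x, τ x = (σ x).subst τ) ∧
    ∀ x, e x = (σ x).realize e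

section

variable {M : Type w} [L.Structure M]

/-- The substitution of `t` for `x`. -/
def single (x : ℕ) (t : L.Term ℕ) : ℕ → L.Term ℕ := Function.update Term.var x t

theorem subst_single_subst {x : ℕ} {t s : L.Term ℕ} {τ : ℕ → L.Term ℕ} (h : τ x = t.subst τ) :
    (s.subst (single x t)).subst τ = s.subst τ := by
  rw [Term.subst_subst]
  congr 1
  funext y
  by_cases hy : y = x
  · subst hy; simp [single, h]
  · simp [single, hy, Term.subst]

theorem realize_subst_single {x : ℕ} {t s : L.Term ℕ} {e : ℕ → M} (h : e x = t.realize e) :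
    (s.subst (single x t)).realize e = s.realize e := by
  rw [Term.realize_subst]
  congr 1
  funext y
  by_cases hy : y = x
  · subst hy; simp [single, h]
  · simp [single, hy]

theorem subst_single_of_notMem {x : ℕ} {t s : L.Term ℕ} (h : x ∉ s.varFinset) :
    s.subst (single x t) = s := by
  conv_rhs => rw [← Term.subst_var s]
  refine Term.subst_congr fun y hy => ?_
  have : y ≠ x := fun hyx => h (hyx ▸ hy)
  simp [single, this]

/-- Once the occurs check has passed, elimination removes `x` for good; the shrinking variable set
is the outer measure of the unification algorithm. -/
theorem varFinset_subst_single_subset {x : ℕ} {t s : L.Term ℕ} {V : Finset ℕ}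
    (ht : t.varFinset ⊆ V) (hs : s.varFinset ⊆ V) (hx : x ∉ t.varFinset) :
    (s.subst (single x t)).varFinset ⊆ V.erase x := by
  intro y hy
  obtain ⟨z, hz, hy⟩ := Term.mem_varFinset_subst.1 hy
  by_cases hzx : z = x
  · subst hzx
    simp only [single, Function.update_self] at hy
    exact Finset.mem_erase.2 ⟨fun h => hx (h ▸ hy), ht hy⟩
  · simp only [single, Function.update_of_ne hzx, Term.varFinset, Finset.mem_singleton] at hy
    subst hy
    exact Finset.mem_erase.2 ⟨hzx, hs hz⟩

/-- Elimination of the variable `x` by the equation `x = t`. -/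
theorem IsUnifierFor.eliminate {x : ℕ} {t : L.Term ℕ} {E : List (L.Term ℕ × L.Term ℕ)}
    {e : ℕ → M} {σ : ℕ → L.Term ℕ} (hx : x ∉ t.varFinset) (he : e x = t.realize e)
    (h : IsUnifierFor (E.map fun p => (p.1.subst (single x t), p.2.subst (single x t))) e σ) :
    IsUnifierFor ((Term.var x, t) :: E) e fun y => (single x t y).subst σ := by
  obtain ⟨h₁, h₂, h₃⟩ := h
  refine ⟨?_, ?_, ?_⟩
  · intro p hp
    rcases List.mem_cons.1 hp with rfl | hp
    · simp only [← Term.subst_subst, subst_single_of_notMem hx]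
      simp [Term.subst, single]
    · simpa only [← Term.subst_subst] using h₁ _ (List.mem_map_of_mem hp)
  · intro τ hτ y
    have hxt : τ x = t.subst τ := hτ _ List.mem_cons_self
    have hσ := h₂ τ fun p hp => by
      obtain ⟨q, hq, rfl⟩ := List.mem_map.1 hp
      simpa only [subst_single_subst hxt] using hτ q (List.mem_cons_of_mem _ hq)
    rw [Term.subst_subst]
    simp only [← hσ]
    exact (subst_single_subst (s := Term.var y) hxt).symm
  · intro y
    rw [Term.realize_subst]
    simp only [← h₃]
    exact (realize_subst_single (s := Term.var y) he).symm

theorem IsUnifierFor.swap {s t : L.Term ℕ} {E : List (L.Term ℕ × L.Term ℕ)}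
    {e : ℕ → M} {σ : ℕ → L.Term ℕ} (h : IsUnifierFor ((s, t) :: E) e σ) :
    IsUnifierFor ((t, s) :: E) e σ := by
  simp only [IsUnifierFor, List.forall_mem_cons] at h ⊢
  exact ⟨⟨h.1.1.symm, h.1.2⟩, fun τ hτ => h.2.1 τ ⟨hτ.1.symm, hτ.2⟩, h.2.2⟩

/-- Equations that have a solution in a structure with free equality have a most general unifier,
through which that solution factors. -/
theorem exists_isUnifierFor (hM : FreeEquality L M) (e : ℕ → M) (V : Finset ℕ)
    (E : List (L.Term ℕ × L.Term ℕ))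
    (hV : ∀ p ∈ E, p.1.varFinset ⊆ V ∧ p.2.varFinset ⊆ V)
    (he : ∀ p ∈ E, p.1.realize e = p.2.realize e) : ∃ σ, IsUnifierFor E e σ := by
  -- Elimination shrinks the variable set; decomposing an equation or dropping `x = x` keeps it and
  -- lowers the total size of the left sides.
  induction V using Finset.strongInduction generalizing E with
  | H V ihV =>
  induction hN : (E.map fun p => Term.size p.1).sum using Nat.strong_induction_on
    generalizing E with
  | _ N ihN =>
  have elim : ∀ (x : ℕ) (t : L.Term ℕ) (E' : List (L.Term ℕ × L.Term ℕ)), x ∈ V →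
      t.varFinset ⊆ V → (∀ p ∈ E', p.1.varFinset ⊆ V ∧ p.2.varFinset ⊆ V) →
      e x = t.realize e → (∀ p ∈ E', p.1.realize e = p.2.realize e) → t ≠ Term.var x →
      ∃ σ, IsUnifierFor ((Term.var x, t) :: E') e σ := by
    intro x t E' hxV htV hV' hxt he' hne
    -- The occurs check cannot fail: acyclicity would contradict the solution `e`.
    have hx : x ∉ t.varFinset := fun hx => hM.acyclic x t hx hne e hxt
    obtain ⟨σ, hσ⟩ := ihV _ (Finset.erase_ssubset hxV)
      (E'.map fun p => (p.1.subst (single x t), p.2.subst (single x t)))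
      (fun p hp => by
        obtain ⟨q, hq, rfl⟩ := List.mem_map.1 hp
        exact ⟨varFinset_subst_single_subset htV (hV' q hq).1 hx,
          varFinset_subst_single_subset htV (hV' q hq).2 hx⟩)
      (fun p hp => by
        obtain ⟨q, hq, rfl⟩ := List.mem_map.1 hp
        simpa only [realize_subst_single hxt] using he' q hq)
    exact ⟨_, hσ.eliminate hx hxt⟩
  match E, hV, he, hN with
  | [], _, _, _ =>
    exact ⟨Term.var, by simp, fun τ _ x => rfl, fun x => rfl⟩
  | (s, t) :: E, hV, he, hN =>
    rw [List.forall_mem_cons] at hV he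
    obtain ⟨⟨hsV, htV⟩, hV⟩ := hV
    obtain ⟨hst, he⟩ := he
    cases s with
    | var x =>
      by_cases htx : t = Term.var x
      · subst htx
        obtain ⟨σ, h₁, h₂, h₃⟩ := ihN (E.map fun p => Term.size p.1).sum
          (by simp [Term.size] at hN; omega) E hV he rfl
        exact ⟨σ, by simpa using h₁, fun τ hτ => h₂ τ fun p hp => hτ p (List.mem_cons_of_mem _ hp),
          h₃⟩
      · exact elim x t E (by simpa using hsV) htV hV hst he htx
    | func f ss =>
      cases t with
      | var x =>
        obtain ⟨σ, hσ⟩ := elim x (Term.func f ss) E (by simpa using htV) hsV hV hst.symm he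
          (by simp)
        exact ⟨σ, hσ.swap⟩
      | @func m g ts =>
        -- A clash of function symbols is likewise excluded by the solution `e`.
        have hfg := not_not.1 (mt (hM.disjoint f g (fun i => (ss i).realize e)
          fun i => (ts i).realize e) (not_not.2 hst))
        cases hfg
        have hargs := hM.injective _ _ _ hst
        have hmem : ∀ {C : L.Term ℕ × L.Term ℕ → Prop},
            (∀ p ∈ List.ofFn (fun i => (ss i, ts i)) ++ E, C p) ↔
              (∀ i, C (ss i, ts i)) ∧ ∀ p ∈ E, C p := by
          intro C
          simp only [List.forall_mem_append, List.forall_mem_ofFn_iff]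
        obtain ⟨σ, h₁, h₂, h₃⟩ := ihN _
          (by
            simp only [List.map_cons, List.sum_cons, Term.size] at hN
            simp only [← hN]
            -- Decomposition removes exactly one symbol from the left sides, the outer `f`.
            rw [show 1 + ∑ i, Term.size (ss i) + (E.map fun p => Term.size p.1).sum =
              ((List.ofFn (fun i => (ss i, ts i)) ++ E).map fun p => Term.size p.1).sum + 1 by
                simp [List.map_ofFn, List.sum_ofFn]; omega]
            exact Nat.lt_succ_self _)
          (List.ofFn (fun i => (ss i, ts i)) ++ E)
          (hmem.2 ⟨fun i => ⟨fun x hx => hsV (by simpa using ⟨i, hx⟩),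
            fun x hx => htV (by simpa using ⟨i, hx⟩)⟩, hV⟩)
          (hmem.2 ⟨fun i => congrFun hargs i, he⟩) rfl
        refine ⟨σ, ?_, fun τ hτ => h₂ τ ?_, h₃⟩
        · rw [hmem] at h₁
          rw [List.forall_mem_cons]
          exact ⟨congrArg (Term.func f) (funext h₁.1), h₁.2⟩
        · rw [List.forall_mem_cons] at hτ
          refine hmem.2 ⟨fun i => ?_, hτ.2⟩
          have := hτ.1
          simp only [Term.subst, Term.func.injEq, heq_eq_eq, true_and] at this
          exact congrFun this i

/-- Atoms that coincide under an assignment into a structure with free equality have a most general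
unifier, through which that assignment factors. -/
theorem exists_isMGU (hM : FreeEquality L M) {k : ℕ} (r : L.Relations k)
    (a b : Fin k → L.Term ℕ) (e : ℕ → M) (h : ∀ i, (a i).realize e = (b i).realize e) :
    ∃ σ : ℕ → L.Term ℕ, IsMGU σ ⟨k, r, a⟩ ⟨k, r, b⟩ ∧ ∀ x, e x = (σ x).realize e := by
  obtain ⟨σ, h₁, h₂, h₃⟩ := exists_isUnifierFor hM e
    (Finset.univ.biUnion fun i => (a i).varFinset ∪ (b i).varFinset)
    (List.ofFn fun i => (a i, b i))
    (by
      rw [List.forall_mem_ofFn_iff]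
      exact fun i => ⟨fun x hx => by simpa using ⟨i, Or.inl hx⟩,
        fun x hx => by simpa using ⟨i, Or.inr hx⟩⟩)
    (by rwa [List.forall_mem_ofFn_iff])
  rw [List.forall_mem_ofFn_iff] at h₁
  refine ⟨σ, ⟨?_, fun τ hτ => ⟨τ, h₂ τ ?_⟩⟩, h₃⟩
  · simpa [Atom.subst] using funext h₁
  · rw [List.forall_mem_ofFn_iff]
    simp only [Atom.subst, Atom.mk.injEq, heq_eq_eq, true_and] at hτ
    exact congrFun hτ

end

/-! ### Standardizing apart -/

theorem Atom.finite_vars (A : Atom L ℕ) : A.vars.Finite :=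
  (Set.finite_iUnion fun i => (A.args i).varFinset.finite_toSet).subset fun _ ⟨i, hx⟩ =>
    Set.mem_iUnion.2 ⟨i, hx⟩

theorem Query.finite_vars (Q : Query L) : (Query.vars Q).Finite :=
  (Q.finite_toSet.biUnion fun l _ => l.atom.finite_vars).subset fun _ ⟨_, hl, hx⟩ =>
    Set.mem_biUnion hl hx

theorem Clause.finite_vars (c : Clause L) : c.vars.Finite :=
  c.head.finite_vars.union (Query.finite_vars c.body)

theorem Atom.vars_rename (A : Atom L ℕ) (ρ : Equiv.Perm ℕ) :
    (A.subst fun x => Term.var (ρ x)).vars ⊆ ρ '' A.vars := by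
  rintro y ⟨i, hy⟩
  obtain ⟨x, hx, hy⟩ := Term.mem_varFinset_subst.1 hy
  simp only [Term.varFinset, Finset.mem_singleton] at hy
  exact ⟨x, ⟨i, hx⟩, hy.symm⟩

theorem Clause.vars_rename (c : Clause L) (ρ : Equiv.Perm ℕ) : (c.rename ρ).vars ⊆ ρ '' c.vars := by
  rintro y (hy | ⟨l, hl, hy⟩)
  · exact Set.image_mono Set.subset_union_left (c.head.vars_rename ρ hy)
  · obtain ⟨l, hl', rfl⟩ := List.mem_map.1 hl
    rw [Literal.atom_subst] at hy
    obtain ⟨x, hx, rfl⟩ := l.atom.vars_rename ρ hy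
    exact ⟨x, Or.inr ⟨l, hl', hx⟩, rfl⟩

/-- A finite set of natural numbers can be moved off another one by a permutation. -/
theorem exists_perm_disjoint_image {s t : Set ℕ} (hs : s.Finite) (ht : t.Finite) :
    ∃ ρ : Equiv.Perm ℕ, Disjoint (ρ '' s) t := by
  obtain ⟨N, hN⟩ := (hs.union ht).bddAbove
  -- The permutation exchanges the blocks `[0, N]` and `[N+1, 2N+1]`, where `N` bounds both sets.
  have hinv : Function.Involutive fun x : ℕ =>
      if x ≤ N then x + (N + 1) else if x ≤ 2 * N + 1 then x - (N + 1) else x := by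
    intro x
    dsimp only
    split_ifs <;> omega
  refine ⟨hinv.toPerm, Set.disjoint_left.2 ?_⟩
  rintro _ ⟨x, hx, rfl⟩ hxt
  have h₁ : x ≤ N := hN (Or.inl hx)
  have h₂ := hN (Or.inr hxt)
  simp only [Function.Involutive.coe_toPerm, h₁, if_true] at h₂
  omega

theorem Clause.exists_rename_disjoint (c : Clause L) (Q : Query L) :
    ∃ ρ : Equiv.Perm ℕ, Disjoint (c.rename ρ).vars (Query.vars Q) := by
  obtain ⟨ρ, hρ⟩ := exists_perm_disjoint_image c.finite_vars (Query.finite_vars Q)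
  exact ⟨ρ, hρ.mono_left (c.vars_rename ρ)⟩

/-! ### Soundness with respect to complete models -/

section Soundness

variable {M : Type w} [L.Structure M] {P : Program L}

theorem Clause.subst_head_rename (c : Clause L) (ρ : Equiv.Perm ℕ) (σ : ℕ → L.Term β) :
    (c.rename ρ).head.subst σ = c.head.subst (fun x => σ (ρ x)) := by
  simp only [Clause.rename, Atom.subst_subst]
  rfl

theorem Clause.subst_body_rename (c : Clause L) (ρ : Equiv.Perm ℕ) (σ : ℕ → L.Term ℕ) :
    Query.subst (c.rename ρ).body σ = Query.subst c.body (fun x => σ (ρ x)) := by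
  simp only [Clause.rename, Query.subst_subst]
  rfl

theorem realize_head_of_realize_body (hM : IsModel M P) {c : Clause L} (hc : c ∈ P)
    {σ : ℕ → L.Term ℕ} {e : ℕ → M} (h : ∀ l ∈ Query.subst c.body σ, l.Realize M e) :
    (c.head.subst σ).Realize M e := by
  rw [Atom.realize_subst]
  refine hM c hc _ fun l hl => ?_
  rw [← Literal.realize_subst]
  exact h _ (List.mem_map_of_mem hl)

theorem mem_negStar_of_mem_body {c : Clause L} (hc : c ∈ P) {A : Atom L ℕ}
    (hA : Literal.neg A ∈ c.body) : A.rel ∈ NegStar P :=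
  ⟨A.rel, ⟨c, hc, A, hA, rfl⟩, Relation.ReflTransGen.refl⟩

/-- `Neg*` is closed under dependence, so resolving a query over `Neg*` never leaves the part of `M`
governed by the completion. -/
theorem rel_mem_negStar_of_mem_body {c : Clause L} (hc : c ∈ P) (hh : c.head.rel ∈ NegStar P)
    {l : Literal L ℕ} (hl : l ∈ c.body) : l.rel ∈ NegStar P := by
  obtain ⟨p, hp, hd⟩ := hh
  exact ⟨p, hp, hd.tail ⟨c, hc, rfl, l, hl, rfl⟩⟩

/-- If an instance of `A, Q` is true in a model of the completed definition of `A`, then so is an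
instance of one of its resolvents. -/
theorem exists_resolvent_realize (hM : IsCompletionModel M (NegStar P) (NegPart P))
    {A : Atom L ℕ} {Q : Query L} (hA : A.rel ∈ NegStar P) {e : ℕ → M}
    (he : ∀ l ∈ Literal.pos A :: Q, l.Realize M e) :
    ∃ c ∈ P, c.head.rel = A.rel ∧ ∃ (ρ : Equiv.Perm ℕ) (σ : ℕ → L.Term ℕ) (e' : ℕ → M),
      Resolvent P (Literal.pos A :: Q) (Query.subst ((c.rename ρ).body ++ Q) σ) ∧
      ∀ l ∈ Query.subst ((c.rename ρ).body ++ Q) σ, l.Realize M e' := by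
  obtain ⟨k, r, a⟩ := A
  obtain ⟨c, hc, b, hcb, e', hab, hbody⟩ :=
    (hM.completedDef r hA fun i => (a i).realize e).1 (he _ List.mem_cons_self)
  obtain ⟨ρ, hρ⟩ := c.exists_rename_disjoint (Literal.pos ⟨k, r, a⟩ :: Q)
  have hhead : (c.rename ρ).head = ⟨k, r, fun i => (b i).subst fun x => Term.var (ρ x)⟩ := by
    simp only [Clause.rename, hcb]
    rfl
  classical
  -- Standardizing apart allows the assignments for the query and for the clause to be glued into
  -- one that solves the unification problem.
  let e₀ : ℕ → M := fun x =>
    if x ∈ Query.vars (Literal.pos ⟨k, r, a⟩ :: Q) then e x else e' (ρ.symm x)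
  have hQ : ∀ l ∈ Literal.pos ⟨k, r, a⟩ :: Q, ∀ x ∈ l.atom.vars, e₀ x = e x :=
    fun l hl x hx => if_pos ⟨l, hl, hx⟩
  have hcl : ∀ x ∈ (c.rename ρ).vars, e₀ x = e' (ρ.symm x) :=
    fun x hx => if_neg (Set.disjoint_left.1 hρ hx)
  obtain ⟨σ, hσ, hσe⟩ := exists_isMGU hM.freeEquality r a
    (fun i => (b i).subst fun x => Term.var (ρ x)) e₀ fun i => by
      have h₁ : (a i).realize e₀ = (a i).realize e :=
        Term.realize_congr fun x hx => hQ _ List.mem_cons_self x ⟨i, hx⟩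
      have h₂ : ((b i).subst fun x => Term.var (ρ x)).realize e₀ =
          ((b i).subst fun x => Term.var (ρ x)).realize fun x => e' (ρ.symm x) :=
        Term.realize_congr fun x hx => hcl x (Or.inl (by rw [hhead]; exact ⟨i, hx⟩))
      rw [h₁, h₂, hab i]
      simp
  refine ⟨c, hc.1, by rw [hcb]; rfl, ρ, σ, e₀, .mk _ Q c hc.1 ρ σ hρ (hhead ▸ hσ), ?_⟩
  intro l hl
  obtain ⟨l, hl', rfl⟩ := List.mem_map.1 hl
  rw [Literal.realize_subst]
  simp only [← hσe]
  rcases List.mem_append.1 hl' with hl | hl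
  · rw [Literal.realize_congr fun x hx => hcl x (Or.inr ⟨l, hl, hx⟩)]
    obtain ⟨l, hlc, rfl⟩ := List.mem_map.1 hl
    rw [Literal.realize_subst]
    simpa using hbody l hlc
  · exact (Literal.realize_congr (hQ l (List.mem_cons_of_mem _ hl))).2
      (he l (List.mem_cons_of_mem _ hl))

/-- What an outcome says about the complete model `M`. -/
def OutcomeHolds (P : Program L) (M : Type w) [L.Structure M] (Q : Query L) : Outcome → Prop
  | .success => (∀ A, Literal.neg A ∈ Q → A.rel ∈ NegStar P) →
      ∃ θ : ℕ → L.Term ℕ, ∀ e : ℕ → M, ∀ l ∈ Query.subst Q θ, l.Realize M e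
  | .failure => (∀ l ∈ Q, l.rel ∈ NegStar P) → ∀ e : ℕ → M, ¬ ∀ l ∈ Q, l.Realize M e

/-- Soundness of LDNF-resolution with respect to complete models. -/
theorem HasOutcome.sound (hM : IsCompleteModel M P) {o : Outcome} {Q : Query L}
    (h : HasOutcome P o Q) : OutcomeHolds P M Q o := by
  induction h with
  | success_nil => exact fun _ => ⟨Term.var, fun e l hl => by simp [Query.subst] at hl⟩
  | success_pos A Q Q' hr h ih =>
    intro hneg
    cases hr with
    | mk A Q c hc ρ σ apart mgu =>
    -- Negative literals new in the resolvent come from a clause body, hence belong to `Neg*`.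
    obtain ⟨θ, hθ⟩ := ih (by
      intro B hB
      obtain ⟨l, hl, hlB⟩ := List.mem_map.1 hB
      have hrel : B.rel = l.rel := by
        rw [← l.rel_subst σ, hlB]; rfl
      cases l with
      | pos => simp [Literal.subst] at hlB
      | neg B' =>
        rw [hrel]
        rcases List.mem_append.1 hl with hl | hl
        · obtain ⟨l, hl, hlB⟩ := List.mem_map.1 hl
          cases l with
          | pos => simp [Literal.subst] at hlB
          | neg B'' =>
            rw [← hlB, Literal.rel_subst]
            exact mem_negStar_of_mem_body hc hl
        · exact hneg B' (List.mem_cons_of_mem _ hl))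
    refine ⟨fun x => (σ x).subst θ, fun e l hl => ?_⟩
    rw [Query.subst_append, Query.subst_append, Clause.subst_body_rename] at hθ
    simp only [Query.subst_subst] at hθ
    rcases List.mem_cons.1 hl with rfl | hl
    · change (A.subst _).Realize M e
      rw [← Atom.subst_subst, mgu.1, Clause.subst_head_rename, Atom.subst_subst]
      exact realize_head_of_realize_body hM.1 hc fun l hl => hθ e l (List.mem_append_left _ hl)
    · exact hθ e l (List.mem_append_right _ hl)
  | success_neg A Q hA hfail h ihf ih =>
    intro hneg
    obtain ⟨θ, hθ⟩ := ih fun B hB => hneg B (List.mem_cons_of_mem _ hB)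
    refine ⟨θ, fun e l hl => ?_⟩
    rcases List.mem_cons.1 hl with rfl | hl
    · have := ihf (by simpa [Literal.rel, Literal.atom] using hneg A List.mem_cons_self) e
      simpa [Literal.subst, Atom.subst_of_isGround hA, Literal.Realize] using this
    · exact hθ e l hl
  | failure_pos A Q h ih =>
    intro hrel e he
    have hA : A.rel ∈ NegStar P := hrel _ List.mem_cons_self
    obtain ⟨c, hc, hcA, ρ, σ, e', hr, he'⟩ := exists_resolvent_realize (hM.2 ⟨_, hA⟩) hA he
    refine ih _ hr (fun l hl => ?_) e' he'
    obtain ⟨l, hl', rfl⟩ := List.mem_map.1 hl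
    rw [Literal.rel_subst]
    rcases List.mem_append.1 hl' with hl | hl
    · obtain ⟨l, hlc, rfl⟩ := List.mem_map.1 hl
      rw [Literal.rel_subst]
      exact rel_mem_negStar_of_mem_body hc (hcA ▸ hA) hlc
    · exact hrel l (List.mem_cons_of_mem _ hl)
  | failure_neg A Q hA hsucc ih =>
    intro _ e he
    -- A single positive literal meets the side condition vacuously, and the ground atom `A` is
    -- unchanged by `θ`.
    obtain ⟨θ, hθ⟩ := ih (by simp)
    have := hθ e ((Literal.pos A).subst θ) (by simp [Query.subst])
    simp only [Literal.subst, Atom.subst_of_isGround hA] at this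
    exact he _ List.mem_cons_self this
  | failure_neg_next A Q hA hfail h ihf ih =>
    intro hrel e he
    exact ih (fun l hl => hrel l (List.mem_cons_of_mem _ hl)) e
      fun l hl => he l (List.mem_cons_of_mem _ hl)

theorem not_realize_of_failure (hM : IsCompleteModel M P) {A : Atom L ℕ}
    (h : HasOutcome P .failure [Literal.pos A]) (hA : A.rel ∈ NegStar P) (e : ℕ → M) :
    ¬ A.Realize M e := by
  have := h.sound hM (by simpa [Literal.rel, Literal.atom] using hA) e
  simpa [Literal.Realize] using this

end Soundness

/-! ### Termination -/

/-- All sequences of moves from `Q` are finite. -/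
abbrev Terminates (P : Program L) (Q : Query L) : Prop := Acc (fun Q' Q => Next P Q Q') Q

theorem Terminates.allDerivationsFinite {P : Program L} {Q : Query L} (h : Terminates P Q) :
    AllDerivationsFinite P Q := by
  induction h with
  | intro Q _ ih =>
    rintro ⟨s, rfl, hs⟩
    exact ih (s 1) (hs 0) ⟨fun k => s (k + 1), rfl, fun k => hs (k + 1)⟩

theorem terminates_nil (P : Program L) : Terminates P [] :=
  ⟨_, fun _ h => by rcases h with ⟨_, _, ⟨⟩⟩⟩

theorem Resolvent.definedIn {P : Program L} {A : Atom L ℕ} {Q Q' : Query L}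
    (h : Resolvent P (Literal.pos A :: Q) Q') : DefinedIn P A.rel := by
  cases h with
  | mk _ _ c hc ρ σ apart mgu =>
    have := congrArg Atom.rel mgu.1
    simp only [Clause.subst_head_rename, Atom.rel_subst] at this
    exact ⟨c, hc, this.symm⟩

/-- `l` is true in `M` under all assignments, provided that it is positive or its relation belongs
to `Neg*_P`. -/
def TrueIn (P : Program L) (M : Type w) [L.Structure M] (l : Literal L ℕ) : Prop :=
  (∀ A, l = Literal.neg A → A.rel ∈ NegStar P) → ∀ e : ℕ → M, l.Realize M e

/-- Termination of all instances of `C` that are reached from `l, C` by the removal of `l`. -/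
def ContinuationsTerminate (P : Program L) (M : Type w) [L.Structure M] (l : Literal L ℕ)
    (C : Query L) : Prop :=
  ∀ θ : ℕ → L.Term ℕ, IsDescendant P (l :: C) (C.subst θ) → TrueIn P M (l.subst θ) →
    Terminates P (C.subst θ)

section

variable {M : Type w} [L.Structure M] {P : Program L}

/-- Only two moves are possible: a call, covered by `hA`, and a deletion, which instantiates nothing
and certifies finite failure, so soundness licenses the continuation under the identity
substitution. -/
theorem terminates_neg_cons (hM : IsCompleteModel M P) {A : Atom L ℕ} {C : Query L}
    (hA : A.IsGround → Terminates P [Literal.pos A])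
    (h : ContinuationsTerminate P M (Literal.neg A) C) : Terminates P (Literal.neg A :: C) := by
  refine ⟨_, fun Q' hQ' => ?_⟩
  have hnext := hQ'
  cases hQ' with
  | resolve _ _ h => cases h
  | delete _ _ _ hfail =>
    have := h Term.var (by rw [Query.subst_var]; exact .single hnext) (by
      rw [Literal.subst_var]
      exact fun hneg e => not_realize_of_failure hM hfail (hneg A rfl) e)
    rwa [Query.subst_var] at this
  | call _ _ hg => exact hA hg

/-- A positive literal terminates if, for every clause that applies to it, each body literal
terminates in the instances in which it is selected, the preceding body literals being true. -/
theorem terminates_pos_cons (hM : IsCompleteModel M P) {A : Atom L ℕ} {C : Query L}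
    (hbody : ∀ c ∈ P, ∀ (θ θ' : ℕ → L.Term ℕ) (pre post C' : Query L) (l : Literal L ℕ),
      c.body = pre ++ l :: post → c.head.subst θ = A.subst θ' →
      IsDescendant P (Literal.pos A :: C) (l.subst θ :: C') →
      (∀ l' ∈ pre, ∀ e : ℕ → M, (l'.subst θ).Realize M e) →
      ContinuationsTerminate P M (l.subst θ) C' → Terminates P (l.subst θ :: C'))
    (h : ContinuationsTerminate P M (Literal.pos A) C) : Terminates P (Literal.pos A :: C) := by
  refine ⟨_, fun Q' hQ' => ?_⟩
  have hnext := hQ'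
  cases hQ' with
  | resolve _ _ hr =>
  cases hr with
  | mk _ _ c hc ρ σ apart mgu =>
  -- Invariant: `pre` has been removed and is true under the accumulated answer `θ`; `post` and then
  -- `C` remain.
  have key : ∀ (post pre : Query L) (θ : ℕ → L.Term ℕ), c.body = pre ++ post →
      IsDescendant P (Literal.pos A :: C)
        (Query.subst post (fun x => (σ (ρ x)).subst θ) ++
          Query.subst C fun x => (σ x).subst θ) →
      (∀ l' ∈ pre, ∀ e : ℕ → M, (l'.subst fun x => (σ (ρ x)).subst θ).Realize M e) →
      Terminates P (Query.subst post (fun x => (σ (ρ x)).subst θ) ++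
          Query.subst C fun x => (σ x).subst θ) := by
    intro post
    have hhead : ∀ θ : ℕ → L.Term ℕ, (c.head.subst fun x => (σ (ρ x)).subst θ) =
        A.subst fun x => (σ x).subst θ := by
      intro θ
      rw [← Atom.subst_subst A, mgu.1, Clause.subst_head_rename, Atom.subst_subst]
    induction post with
    | nil =>
      intro pre θ hpre hd htrue
      -- The body is used up and true, so the head, which equals this instance of `A`, is true as
      -- well.
      refine h _ hd fun _ e => ?_
      change (A.subst _).Realize M e
      rw [← hhead θ]
      refine realize_head_of_realize_body hM.1 hc fun l hl => ?_
      obtain ⟨l, hl', rfl⟩ := List.mem_map.1 hl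
      exact htrue l (by simpa [hpre] using hl') e
    | cons l post ih =>
      intro pre θ hpre hd htrue
      -- The rest of the body together with `C` is the continuation of `l`; its answer `η` is
      -- composed with `θ`, and `l` joins `pre`.
      refine hbody c hc _ _ pre post
        (Query.subst post (fun x => (σ (ρ x)).subst θ) ++ Query.subst C fun x => (σ x).subst θ)
        l hpre (hhead θ) hd htrue fun η hη hl => ?_
      have hsubst := hd.trans hη
      rw [Query.subst_append] at hsubst ⊢
      simp only [Query.subst_subst, Term.subst_subst] at hsubst ⊢
      refine ih (pre ++ [l]) (fun x => (θ x).subst η) (by simp [hpre]) hsubst ?_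
      simp only [← Term.subst_subst, ← Literal.subst_subst _ _ η]
      intro l' hl' e
      rcases List.mem_append.1 hl' with hl' | hl'
      · rw [Literal.realize_subst]
        exact htrue l' hl' _
      · obtain rfl := List.mem_singleton.1 hl'
        refine hl (fun B hB => ?_) e
        cases l' with
        | pos => simp [Literal.subst] at hB
        | neg B' =>
          simp only [Literal.subst, Literal.neg.injEq] at hB
          rw [← hB]
          exact mem_negStar_of_mem_body hc (A := B') (by simp [hpre])
  have hQ' : Query.subst ((c.rename ρ).body ++ C) σ =
      Query.subst c.body (fun x => (σ (ρ x)).subst Term.var) ++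
        Query.subst C fun x => (σ x).subst Term.var := by
    simp only [Term.subst_var, Query.subst_append, Clause.subst_body_rename]
  rw [hQ'] at hnext ⊢
  exact key c.body [] Term.var rfl (.single hnext) (by simp)

end

/-! ### Induction along the hierarchy -/

section Hierarchy

variable {n : ℕ} {R : Fin n → Program L} {lev : Fin n → LevelMapping L}

/-- A relation that occurs in a module is not defined in a later one. -/
theorem IsHierarchy.le_of_definedIn (hR : IsHierarchy R) {i j : Fin n} {p : Rel L}
    (hi : OccursIn (R i) p) (hj : DefinedIn (R j) p) : j ≤ i := by
  by_contra! hij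
  obtain ⟨c, hc, h⟩ := hi
  exact hR j p hj ⟨c, Set.mem_iUnion.2 ⟨⟨i, hij⟩, hc⟩, h⟩

theorem IsHierarchy.eq_of_definedIn (hR : IsHierarchy R) {i j : Fin n} {p : Rel L}
    (hi : DefinedIn (R i) p) (hj : DefinedIn (R j) p) : i = j := by
  obtain ⟨c, hc, h⟩ := hi
  obtain ⟨d, hd, h'⟩ := hj
  exact le_antisymm (hR.le_of_definedIn ⟨d, hd, Or.inl h'⟩ ⟨c, hc, h⟩)
    (hR.le_of_definedIn ⟨c, hc, Or.inl h⟩ ⟨d, hd, h'⟩)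

theorem definedIn_iUnion {p : Rel L} : DefinedIn (⋃ i, R i) p ↔ ∃ i, DefinedIn (R i) p := by
  simp only [DefinedIn, Set.mem_iUnion]
  exact ⟨fun ⟨c, ⟨i, hc⟩, h⟩ => ⟨i, c, hc, h⟩, fun ⟨i, c, hc, h⟩ => ⟨c, ⟨i, hc⟩, h⟩⟩

theorem IsBounded.exists_le {lev : LevelMapping L} {A : Atom L ℕ} (h : IsBounded lev A) :
    ∃ m, ∀ γ : ℕ → L.Term Empty, lev (A.subst γ) ≤ m := by
  obtain ⟨m, hm⟩ := Set.Finite.bddAbove h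
  exact ⟨m, fun γ => hm ⟨γ, rfl⟩⟩

/-- The levels of a selected body literal are below those of the instance of the head. -/
theorem IsAcceptable.lev_lt {P : Program L} {lev : LevelMapping L} {M : Type w} [L.Structure M]
    (h : IsAcceptable P lev M) {c : Clause L} (hc : c ∈ P) {pre post : Query L}
    {l : Literal L ℕ} (hbody : c.body = pre ++ l :: post) {θ : ℕ → L.Term ℕ}
    (hpre : ∀ l' ∈ pre, ∀ e : ℕ → M, (l'.subst θ).Realize M e) (γ : ℕ → L.Term Empty) :
    lev ((l.subst θ).atom.subst γ) < lev ((c.head.subst θ).subst γ) := by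
  rw [← Literal.atom_subst, Literal.subst_subst, Atom.subst_subst]
  refine h c hc _ pre post l hbody fun l' hl' => ?_
  rw [← Literal.subst_subst, Literal.Holds, Literal.realize_subst]
  -- The assignment sends each variable to the value in `M` of its ground term.
  exact hpre l' hl' _

/-- `l, C` terminates if its continuations do and the atom of `l` terminates where it is selected. -/
theorem terminates_cons {M : Type w} [L.Structure M] {P : Program L} (hM : IsCompleteModel M P)
    {l : Literal L ℕ} {C : Query L}
    (hpos : ∀ C', IsDescendant P (l :: C) (Literal.pos l.atom :: C') →
      ContinuationsTerminate P M (Literal.pos l.atom) C' →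
      Terminates P (Literal.pos l.atom :: C'))
    (h : ContinuationsTerminate P M l C) : Terminates P (l :: C) := by
  cases l with
  | pos A => exact hpos C .refl h
  | neg A =>
    -- The root of the subsidiary tree is a call with empty continuation, so boundedness of called
    -- atoms also covers negated ones.
    exact terminates_neg_cons hM
      (fun hA => hpos [] (.single (.call A C hA)) fun _ _ _ => terminates_nil P) h

/-- Termination from a descendant whose first literal is defined in `R i` and has levels at most
`m`, by induction on `i` and then on `m`. -/
theorem terminates_pos_of_level_le [Nonempty L.Constants] (hR : IsHierarchy R)
    {M : Type w} [L.Structure M] (hM : IsCompleteModel M (⋃ i, R i))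
    (hacc : ∀ i, IsAcceptable (R i) (lev i) M) {Q : Query L} (hQ : IsStronglyBounded R lev Q)
    (i : Fin n) (m : ℕ) {A : Atom L ℕ} {C : Query L}
    (hd : IsDescendant (⋃ i, R i) Q (Literal.pos A :: C)) (hA : DefinedIn (R i) A.rel)
    (hm : ∀ γ : ℕ → L.Term Empty, lev i (A.subst γ) ≤ m)
    (h : ContinuationsTerminate (⋃ i, R i) M (Literal.pos A) C) :
    Terminates (⋃ i, R i) (Literal.pos A :: C) := by
  induction i using WellFoundedLT.induction generalizing m A C with
  | ind i ihi =>
  induction m using Nat.strong_induction_on generalizing A C with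
  | h m ihm =>
  refine terminates_pos_cons hM (fun c hc θ θ' pre post C' l hbody hhead hl hpre hC' => ?_) h
  obtain ⟨j, hcj⟩ := Set.mem_iUnion.1 hc
  have hrel : c.head.rel = A.rel := by simpa using congrArg Atom.rel hhead
  obtain rfl := hR.eq_of_definedIn hA ⟨c, hcj, hrel⟩
  refine terminates_cons hM (fun C'' hl' hC'' => ?_) hC'
  have hd' := (hd.trans hl).trans hl'
  by_cases hdef : DefinedIn (⋃ i, R i) (l.subst θ).atom.rel
  · obtain ⟨j, hj⟩ := definedIn_iUnion.1 hdef
    obtain ⟨m', hm'⟩ := (hQ _ ⟨C'', hd'⟩ j hj).exists_le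
    have hocc : OccursIn (R i) (l.subst θ).atom.rel :=
      ⟨c, hcj, Or.inr ⟨l, by simp [hbody], by simp [Literal.rel]⟩⟩
    rcases (hR.le_of_definedIn hocc hj).lt_or_eq with hji | rfl
    · exact ihi j hji m' hd' hj hm' hC''
    -- Same module: ground instances of this instance of the head are ground instances of `A`, so
    -- their levels are at most `m`.
    · have hlt : ∀ γ : ℕ → L.Term Empty, lev j ((l.subst θ).atom.subst γ) < m := fun γ => by
        refine ((hacc j).lev_lt hcj hbody hpre γ).trans_le ?_
        rw [hhead, Atom.subst_subst]
        exact hm _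
      -- A constant provides a ground instance, which forces `m > 0`; otherwise `m - 1` would not be
      -- smaller.
      have h0 := hlt fun _ => FirstOrder.Language.Constants.term (Classical.arbitrary L.Constants)
      exact ihm (m - 1) (by omega) hd' hj (fun γ => Nat.le_sub_one_of_lt (hlt γ)) hC''
  · refine ⟨_, fun Q' hQ' => ?_⟩
    cases hQ' with
    | resolve _ _ hr => exact absurd hr.definedIn hdef

theorem IsStronglyBounded.terminates [Nonempty L.Constants] (hR : IsHierarchy R)
    {M : Type w} [L.Structure M] (hM : IsCompleteModel M (⋃ i, R i))
    (hacc : ∀ i, IsAcceptable (R i) (lev i) M) {Q : Query L} (hQ : IsStronglyBounded R lev Q) :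
    Terminates (⋃ i, R i) Q := by
  have key : ∀ (C : Query L) (θ : ℕ → L.Term ℕ), IsDescendant (⋃ i, R i) Q (C.subst θ) →
      Terminates (⋃ i, R i) (C.subst θ) := by
    intro C
    induction C with
    | nil => exact fun _ _ => terminates_nil _
    | cons l C ih =>
      intro θ hd
      -- Acceptability is not applied to `Q` itself: each selected literal is bounded as a call, so
      -- the truth of the answers to earlier ones is discarded.
      refine terminates_cons (l := l.subst θ) hM (fun C' hl hC' => ?_) fun η hη _ => ?_
      · by_cases hdef : DefinedIn (⋃ i, R i) (l.subst θ).atom.rel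
        · obtain ⟨i, hi⟩ := definedIn_iUnion.1 hdef
          obtain ⟨m, hm⟩ := (hQ _ ⟨C', hd.trans hl⟩ i hi).exists_le
          exact terminates_pos_of_level_le hR hM hacc hQ i m (hd.trans hl) hi hm hC'
        · refine ⟨_, fun Q' hQ' => ?_⟩
          cases hQ' with
          | resolve _ _ hr => exact absurd hr.definedIn hdef
      · change IsDescendant _ _ (Query.subst (Query.subst C θ) η) at hη
        change Terminates _ (Query.subst (Query.subst C θ) η)
        rw [Query.subst_subst] at hη ⊢
        exact ih _ (hd.trans hη)
  simpa only [Query.subst_var] using key Q Term.var (by rw [Query.subst_var]; exact .refl)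

end Hierarchy

end LogicProg

theorem theorem2 {L : FirstOrder.Language.{u, v}} [Nonempty L.Constants] {n : ℕ}
    (R : Fin n → LogicProg.Program L) (hfin : ∀ i, (R i).Finite)
    (hhier : LogicProg.IsHierarchy R)
    (lev : Fin n → LogicProg.LevelMapping L)
    (M : Type w) [L.Structure M] (hM : LogicProg.IsCompleteModel M (⋃ i, R i))
    (hacc : ∀ i, LogicProg.IsAcceptable (R i) (lev i) M)
    (Q : LogicProg.Query L) (hQ : LogicProg.IsStronglyBounded R lev Q) :
    LogicProg.AllDerivationsFinite (⋃ i, R i) Q :=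
  (hQ.terminates hhier hM hacc).allDerivationsFinite
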